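/- Let $n\ge 0$, let $Q$ be a quadratic form with rational coefficients in $n+1$ variables, and let $X=\{[\mathbf x]\in\mathbb P^n(\mathbb R): Q(\mathbf x)=0\}$ be the rational quadric hypersurface it defines. Let $\mathrm{rk}_{\mathbb Q}X$ be the maximal dimension of a subspace $E\subset\mathbb R^{n+1}$ that is spanned by rational vectors and satisfies $Q|_E\equiv 0$. Equip $\mathbb P^n(\mathbb R)$ with the distance $$\mathrm{dist}([\mathbf v],[\mathbf w])=\frac{\|\mathbf v\wedge\mathbf w\|}{\|\mathbf v\|\,\|\mathbf w\|}$$ ($\|\cdot\|$ the Euclidean norm), and for $v=[\mathbf v]\in\mathbb P^n(\mathbb Q)$, with $\mathbf v\in\mathbb Z^{n+1}$ a vector with coprime coordinates, put $H(v)=\max_i|v_i|$. Write $X(\mathbb Q)=X\cap\mathbb P^n(\mathbb Q)$. For $x\in X$ define the (intrinsic) Diophantine exponent $$\beta(x)=\inf\{\beta>0\ :\ \exists\,c>0\ \ \forall\,v\in X(\mathbb Q),\ \ \mathrm{dist}(x,v)\ge c\,H(v)^{-\beta}\}\in[0,+\infty],$$ with $\inf\varnothing=+\infty$. **Theorem (Extremality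 of submanifolds of large dimension).** Let $M\subset X$ be a $k$-dimensional smooth (i.e. $C^\infty$, embedded) submanifold of $\mathbb P^n(\mathbb R)$ with $k\ge\mathrm{rk}_{\mathbb Q}X$. Then $\beta(x)\le 1$ for Lebesgue-almost every $x\in M$, that is, for almost every $x\in M$ with respect to the restriction to $M$ of the $k$-dimensional Hausdorff measure. -/

import Mathlib

open MeasureTheory Measure
open scoped ContDiff

noncomputable section

namespace QuadricApprox

/-- The Euclidean space of homogeneous coordinates, `ℝ^(n+1)`. -/
abbrev Coord (n : ℕ) : Type := EuclideanSpace ℝ (Fin (n + 1))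

/-- The real projective space `ℙⁿ(ℝ)` (a type of its own, so that its metric below is the only
metric on it). -/
def RP (n : ℕ) : Type := Projectivization ℝ (Coord n)

/-- The point `[v]` of `ℙⁿ(ℝ)` given by a nonzero vector `v`. -/
def RP.mk {n : ℕ} (v : Coord n) (hv : v ≠ 0) : RP n := Projectivization.mk ℝ v hv

/-- A nonzero vector on the line `x`. -/
def RP.rep {n : ℕ} (x : RP n) : Coord n := Projectivization.rep x

theorem RP.rep_ne_zero {n : ℕ} (x : RP n) : x.rep ≠ 0 := Projectivization.rep_nonzero x

theorem RP.mk_rep {n : ℕ} (x : RP n) : RP.mk x.rep x.rep_ne_zero = x := Projectivization.mk_rep x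

/-- The Euclidean norm `‖v ∧ w‖` on `Λ²(ℝ^(n+1))`, for which the `e_i ∧ e_j` with `i < j` form an
orthonormal basis: the coordinates of `v ∧ w` are the `2 × 2` minors. -/
def wedgeNorm {n : ℕ} (v w : Coord n) : ℝ :=
  Real.sqrt (∑ p : Fin (n + 1) × Fin (n + 1) with p.1 < p.2, (v p.1 * w p.2 - v p.2 * w p.1) ^ 2)

/-- `dist (x, y) = ‖v_x ∧ v_y‖ / (‖v_x‖ ‖v_y‖)`; independent of the nonzero vectors chosen on
`x` and `y`, see `projDist_mk`. -/
def projDist {n : ℕ} (x y : RP n) : ℝ := wedgeNorm x.rep y.rep / (‖x.rep‖ * ‖y.rep‖)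

/-- Lagrange's identity. -/
theorem wedge_sum_eq {n : ℕ} (v w : Coord n) :
    ∑ p : Fin (n + 1) × Fin (n + 1) with p.1 < p.2, (v p.1 * w p.2 - v p.2 * w p.1) ^ 2
      = ‖v‖ ^ 2 * ‖w‖ ^ 2 - (∑ i, v i * w i) ^ 2 := by
  set f : Fin (n + 1) × Fin (n + 1) → ℝ := fun p => (v p.1 * w p.2 - v p.2 * w p.1) ^ 2 with hf
  have hsplit : ∑ p, f p = 2 * ∑ p : Fin (n + 1) × Fin (n + 1) with p.1 < p.2, f p := by
    have h1 : ∑ p, f p = ∑ p, ((if p.1 < p.2 then f p else 0) + (if p.2 < p.1 then f p else 0)) := by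
      refine Finset.sum_congr rfl fun p _ => ?_
      rcases lt_trichotomy p.1 p.2 with h | h | h
      · simp [h, h.le]
      · simp [hf, h]
      · simp [h, h.le]
    have h2 : ∑ p : Fin (n + 1) × Fin (n + 1), (if p.2 < p.1 then f p else 0)
        = ∑ p : Fin (n + 1) × Fin (n + 1), (if p.1 < p.2 then f p else 0) := by
      refine Fintype.sum_equiv (Equiv.prodComm _ _) _ _ fun p => ?_
      have : f p.swap = f p := by simp only [hf, Prod.fst_swap, Prod.snd_swap]; ring
      simp [this]
    rw [h1, Finset.sum_add_distrib, h2, Finset.sum_filter]; ring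
  have hfull : ∑ p, f p = 2 * (‖v‖ ^ 2 * ‖w‖ ^ 2 - (∑ i, v i * w i) ^ 2) := by
    have e1 : ‖v‖ ^ 2 * ‖w‖ ^ 2 = ∑ p : Fin (n + 1) × Fin (n + 1), v p.1 ^ 2 * w p.2 ^ 2 := by
      rw [EuclideanSpace.real_norm_sq_eq, EuclideanSpace.real_norm_sq_eq, Finset.sum_mul_sum,
        Fintype.sum_prod_type]
    have e2 : ‖v‖ ^ 2 * ‖w‖ ^ 2 = ∑ p : Fin (n + 1) × Fin (n + 1), v p.2 ^ 2 * w p.1 ^ 2 := by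
      rw [e1]
      exact Fintype.sum_equiv (Equiv.prodComm _ _) _ _ fun p => rfl
    have e3 : (∑ i, v i * w i) ^ 2
        = ∑ p : Fin (n + 1) × Fin (n + 1), (v p.1 * w p.1) * (v p.2 * w p.2) := by
      rw [sq, Finset.sum_mul_sum, Fintype.sum_prod_type]
    have e4 : 2 * (‖v‖ ^ 2 * ‖w‖ ^ 2 - (∑ i, v i * w i) ^ 2)
        = ‖v‖ ^ 2 * ‖w‖ ^ 2 + ‖v‖ ^ 2 * ‖w‖ ^ 2 - 2 * (∑ i, v i * w i) ^ 2 := by ring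
    rw [e4]
    nth_rewrite 1 [e1]
    rw [e2, e3, Finset.mul_sum, ← Finset.sum_add_distrib, ← Finset.sum_sub_distrib]
    refine Finset.sum_congr rfl fun p _ => ?_
    simp only [hf]; ring
  linarith

/-- The matrix of the orthogonal projection to the line `ℝ v`, as a Euclidean vector. -/
def projVec {n : ℕ} (v : Coord n) : EuclideanSpace ℝ (Fin (n + 1) × Fin (n + 1)) :=
  WithLp.toLp 2 fun p => v p.1 * v p.2 / ‖v‖ ^ 2

theorem projVec_dist {n : ℕ} (v w : Coord n) (hv : v ≠ 0) (hw : w ≠ 0) :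
    wedgeNorm v w / (‖v‖ * ‖w‖) = dist (projVec v) (projVec w) / Real.sqrt 2 := by
  have hv' : ‖v‖ ≠ 0 := norm_ne_zero_iff.mpr hv
  have hw' : ‖w‖ ≠ 0 := norm_ne_zero_iff.mpr hw
  have hd : ‖v‖ * ‖w‖ = Real.sqrt (‖v‖ ^ 2 * ‖w‖ ^ 2) := by
    rw [← mul_pow, Real.sqrt_sq (by positivity)]
  rw [wedgeNorm, wedge_sum_eq, EuclideanSpace.dist_eq, hd,
    ← Real.sqrt_div' _ (by positivity), ← Real.sqrt_div' _ (by positivity)]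
  congr 1
  have e3 : ∀ a b : Coord n, ∑ p : Fin (n + 1) × Fin (n + 1), (a p.1 * a p.2) * (b p.1 * b p.2)
      = (∑ i, a i * b i) ^ 2 := by
    intro a b
    rw [sq, Finset.sum_mul_sum, Fintype.sum_prod_type]
    exact Finset.sum_congr rfl fun i _ => Finset.sum_congr rfl fun j _ => by ring
  have en : ∀ a : Coord n, ∑ i, a i * a i = ‖a‖ ^ 2 := by
    intro a
    rw [EuclideanSpace.real_norm_sq_eq]
    exact Finset.sum_congr rfl fun i _ => by ring
  have : ∑ p : Fin (n + 1) × Fin (n + 1), dist (projVec v p) (projVec w p) ^ 2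
      = (∑ i, v i * v i) ^ 2 / (‖v‖ ^ 2) ^ 2 + (∑ i, w i * w i) ^ 2 / (‖w‖ ^ 2) ^ 2
        - 2 * (∑ i, v i * w i) ^ 2 / (‖v‖ ^ 2 * ‖w‖ ^ 2) := by
    rw [← e3 v v, ← e3 w w, ← e3 v w, Finset.mul_sum, Finset.sum_div, Finset.sum_div,
      Finset.sum_div, ← Finset.sum_add_distrib, ← Finset.sum_sub_distrib]
    refine Finset.sum_congr rfl fun p _ => ?_
    rw [Real.dist_eq, sq_abs]
    simp only [projVec]
    field_simp
    ring
  rw [this, en, en]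
  field_simp
  ring

theorem projVec_smul {n : ℕ} (a : ℝ) (ha : a ≠ 0) (v : Coord n) : projVec (a • v) = projVec v := by
  ext p
  by_cases hv : v = 0
  · simp [hv]
  have hv' : ‖v‖ ≠ 0 := norm_ne_zero_iff.mpr hv
  simp only [projVec, norm_smul, PiLp.smul_apply, smul_eq_mul, mul_pow, Real.norm_eq_abs, sq_abs]
  field_simp

theorem projVec_rep_mk {n : ℕ} (v : Coord n) (hv : v ≠ 0) :
    projVec (RP.mk v hv).rep = projVec v := by
  obtain ⟨a, ha⟩ := Projectivization.exists_smul_eq_mk_rep ℝ v hv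
  have : (RP.mk v hv).rep = (a : ℝ) • v := ha.symm
  rw [this, projVec_smul _ a.ne_zero]

theorem projDist_eq {n : ℕ} (x y : RP n) :
    projDist x y = dist (projVec x.rep) (projVec y.rep) / Real.sqrt 2 :=
  projVec_dist _ _ x.rep_ne_zero y.rep_ne_zero

theorem projDist_mk {n : ℕ} (v w : Coord n) (hv : v ≠ 0) (hw : w ≠ 0) :
    projDist (RP.mk v hv) (RP.mk w hw) = wedgeNorm v w / (‖v‖ * ‖w‖) := by
  rw [projDist_eq, projVec_rep_mk, projVec_rep_mk, projVec_dist v w hv hw]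

theorem eq_of_projVec_eq {n : ℕ} (x y : RP n) (h : projVec x.rep = projVec y.rep) : x = y := by
  have hx := x.rep_ne_zero
  have hy := y.rep_ne_zero
  have hx' : ‖x.rep‖ ≠ 0 := norm_ne_zero_iff.mpr hx
  have hy' : ‖y.rep‖ ≠ 0 := norm_ne_zero_iff.mpr hy
  obtain ⟨i, hi⟩ : ∃ i, x.rep i ≠ 0 := by
    by_contra hc
    push Not at hc
    exact hx (by ext i; simpa using hc i)
  have hj : ∀ j, x.rep i * x.rep j / ‖x.rep‖ ^ 2 = y.rep i * y.rep j / ‖y.rep‖ ^ 2 := fun j =>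
    congrArg (fun u : EuclideanSpace ℝ (Fin (n + 1) × Fin (n + 1)) => u (i, j)) h
  rw [← x.mk_rep, ← y.mk_rep]
  refine (Projectivization.mk_eq_mk_iff' ℝ _ _ hx hy).mpr
    ⟨y.rep i * ‖x.rep‖ ^ 2 / (‖y.rep‖ ^ 2 * x.rep i), ?_⟩
  ext j
  have := hj j
  simp only [PiLp.smul_apply, smul_eq_mul]
  field_simp at this ⊢
  linarith

/-- `ℙⁿ(ℝ)` with the distance `projDist`. -/
instance instMetricSpaceRP (n : ℕ) : MetricSpace (RP n) where
  dist := projDist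
  dist_self x := by simp [projDist_eq]
  dist_comm x y := by simp only [projDist_eq, dist_comm]
  dist_triangle x y z := by
    simp only [projDist_eq, ← add_div]
    gcongr
    exact dist_triangle _ _ _
  eq_of_dist_eq_zero {x y} h := by
    change projDist x y = 0 at h
    rw [projDist_eq, div_eq_zero_iff] at h
    rcases h with h | h
    · exact eq_of_projVec_eq x y (dist_eq_zero.mp h)
    · exact absurd h (by positivity)

instance instMeasurableSpaceRP (n : ℕ) : MeasurableSpace (RP n) := borel (RP n)

instance instBorelSpaceRP (n : ℕ) : BorelSpace (RP n) := ⟨rfl⟩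

/-! ### Rational quadrics -/

/-- The real quadratic form on `ℝ^(n+1)` with the same (rational) coefficients as `Q`. -/
def realForm {n : ℕ} (Q : QuadraticForm ℚ (Fin (n + 1) → ℚ)) :
    QuadraticForm ℝ (Fin (n + 1) → ℝ) :=
  (Q.toMatrix'.map (algebraMap ℚ ℝ)).toQuadraticForm'

/-- The rational quadric `X = [Q⁻¹(0)]` in `ℙⁿ(ℝ)`. -/
def quadric {n : ℕ} (Q : QuadraticForm ℚ (Fin (n + 1) → ℚ)) : Set (RP n) :=
  {x | ∃ (v : Coord n) (hv : v ≠ 0), x = RP.mk v hv ∧ realForm Q v.ofLp = 0}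

/-- A subspace of `ℝ^(n+1)` is rational if it is spanned by rational vectors. -/
def IsRationalSubspace {n : ℕ} (E : Submodule ℝ (Fin (n + 1) → ℝ)) : Prop :=
  ∃ S : Set (Fin (n + 1) → ℚ), E = Submodule.span ℝ ((fun u i => (u i : ℝ)) '' S)

/-- `Q` vanishes identically on `E`. -/
def IsTotallyIsotropic {n : ℕ} (Q : QuadraticForm ℚ (Fin (n + 1) → ℚ))
    (E : Submodule ℝ (Fin (n + 1) → ℝ)) : Prop :=
  ∀ v ∈ E, realForm Q v = 0

/-- The `ℚ`-rank of the quadric `X` defined by `Q`: the maximal dimension of a totally isotropic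
rational subspace of `ℝ^(n+1)`. -/
def rationalRank {n : ℕ} (Q : QuadraticForm ℚ (Fin (n + 1) → ℚ)) : ℕ :=
  sSup {d : ℕ | ∃ E : Submodule ℝ (Fin (n + 1) → ℝ),
    IsRationalSubspace E ∧ IsTotallyIsotropic Q E ∧ Module.finrank ℝ E = d}

/-! ### Rational points, height, Diophantine exponent -/

/-- Integer vectors with coprime coordinates. -/
def PrimitiveVector (n : ℕ) : Type := {v : Fin (n + 1) → ℤ // Finset.univ.gcd v = 1}

/-- `v` as a real vector. -/
def PrimitiveVector.toReal {n : ℕ} (v : PrimitiveVector n) : Coord n :=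
  WithLp.toLp 2 fun i => (v.1 i : ℝ)

theorem PrimitiveVector.toReal_ne_zero {n : ℕ} (v : PrimitiveVector n) : v.toReal ≠ 0 := by
  intro h
  have h0 : ∀ i ∈ Finset.univ, v.1 i = 0 := fun i _ => by
    have : (v.1 i : ℝ) = 0 := congrArg (fun u : Coord n => u i) h
    exact_mod_cast this
  have h1 := v.2
  rw [Finset.gcd_eq_zero_iff.mpr h0] at h1
  exact zero_ne_one h1

/-- The rational point `[v]`. Every point of `ℙⁿ(ℚ)` is of this form, with `v` unique up to
sign. -/
def PrimitiveVector.point {n : ℕ} (v : PrimitiveVector n) : RP n := RP.mk v.toReal v.toReal_ne_zero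

/-- The height `H([v]) = max |v_i|`. -/
def PrimitiveVector.height {n : ℕ} (v : PrimitiveVector n) : ℕ :=
  Finset.univ.sup fun i => (v.1 i).natAbs

/-- The intrinsic Diophantine exponent
`β(x) = inf {β > 0 | ∃ c > 0, ∀ v ∈ X(ℚ), dist (x, v) ≥ c H(v)^(-β)}`, as an extended real, so that
it is `+∞` when there is no such `β`. -/
def diophantineExponent {n : ℕ} (Q : QuadraticForm ℚ (Fin (n + 1) → ℚ)) (x : RP n) : EReal :=
  sInf ((fun b : ℝ => (b : EReal)) '' {b : ℝ | 0 < b ∧ ∃ c : ℝ, 0 < c ∧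
    ∀ v : PrimitiveVector n, v.point ∈ quadric Q → c * (v.height : ℝ) ^ (-b) ≤ dist x v.point})

/-! ### Smooth submanifolds -/

/-- A `k`-dimensional (embedded) smooth submanifold of `ℝⁿ`: around each of its points there is a
smooth diffeomorphism between open subsets of `ℝⁿ` straightening `S` to a `k`-dimensional linear
subspace. -/
def IsSmoothSubmanifoldEuclidean {n : ℕ} (k : ℕ) (S : Set (EuclideanSpace ℝ (Fin n))) : Prop :=
  ∀ y ∈ S, ∃ (φ : OpenPartialHomeomorph (EuclideanSpace ℝ (Fin n)) (EuclideanSpace ℝ (Fin n)))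
    (W : Submodule ℝ (EuclideanSpace ℝ (Fin n))),
    y ∈ φ.source ∧ ContDiffOn ℝ ∞ φ φ.source ∧ ContDiffOn ℝ ∞ φ.symm φ.target ∧
    Module.finrank ℝ W = k ∧ φ '' (S ∩ φ.source) = φ.target ∩ (W : Set (EuclideanSpace ℝ (Fin n)))

/-- The vector `(y_1, …, 1, …, y_n)` of `ℝ^(n+1)` with `1` in position `i`. -/
def affineVec {n : ℕ} (i : Fin (n + 1)) (y : EuclideanSpace ℝ (Fin n)) : Coord n :=
  WithLp.toLp 2 (i.insertNth (α := fun _ => ℝ) 1 y.ofLp)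

theorem affineVec_ne_zero {n : ℕ} (i : Fin (n + 1)) (y : EuclideanSpace ℝ (Fin n)) :
    affineVec i y ≠ 0 := by
  intro h
  have : affineVec i y i = 0 := by rw [h]; rfl
  simp [affineVec] at this

/-- The inverse of the standard affine chart of `ℙⁿ(ℝ)` on the open set `{[x] | x_i ≠ 0}`. -/
def affinePoint {n : ℕ} (i : Fin (n + 1)) (y : EuclideanSpace ℝ (Fin n)) : RP n :=
  RP.mk (affineVec i y) (affineVec_ne_zero i y)

/-- A `k`-dimensional (embedded) smooth submanifold of `ℙⁿ(ℝ)`: in each of the `n + 1` standard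
affine charts it is a `k`-dimensional smooth submanifold of `ℝⁿ`. -/
def IsSmoothSubmanifold {n : ℕ} (k : ℕ) (M : Set (RP n)) : Prop :=
  ∀ i : Fin (n + 1), IsSmoothSubmanifoldEuclidean k (affinePoint i ⁻¹' M)

end QuadricApprox

end

namespace QuadricApprox

/-! ### The projective metric -/

/-! Fix b > 1 and parametrize M locally by an immersion of a k-dimensional space W into an affine
chart x_i = 1. By Borel–Cantelli over dyadic heights h = 2^j with radius δ = h^(-b), almost every
parameter is eventually outside `nearRational`; letting b decrease to 1 gives the theorem.

The measure bound comes from looking at scale ρ = a/h, with a small and fixed. Let v, w be isotropic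
integer vectors of height less than 2h, with v/v_i and w/w_i at distance O(a/h). Their polar form
equals -v_i w_i Q(v/v_i - w/w_i), hence is O(a²); its values on integer vectors are discrete, so it
vanishes (`polar_eq_zero_of_near`). Thus the rational points relevant to one ball of radius 5ρ span
a totally isotropic rational subspace, of dimension at most rk_ℚ X ≤ k, and in the chart they lie in
an affine subspace of dimension at most k - 1. Some direction of W is therefore mapped orthogonally
to that affine subspace (`exists_direction_inner_const`), and parameters close to these points are
confined to a slab of width O(δ) across it (`measure_slab_le`).

Such a slab fills a proportion O(δ/ρ) = O(h^(1-b)) of the ball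
(`measure_nearRational_inter_ball_le`). A Vitali covering makes this global, and the sum over h =
2^j is a geometric series (`summable_measure_nearRational`). -/

theorem abs_minor_le_wedgeNorm {n : ℕ} (v w : Coord n) (a b : Fin (n + 1)) :
    |v a * w b - v b * w a| ≤ wedgeNorm v w := by
  have key : ∀ a b : Fin (n + 1), a < b → |v a * w b - v b * w a| ≤ wedgeNorm v w := by
    intro a b hab
    rw [wedgeNorm]
    refine Real.abs_le_sqrt ?_
    exact Finset.single_le_sum (f := fun p : Fin (n + 1) × Fin (n + 1) =>
      (v p.1 * w p.2 - v p.2 * w p.1) ^ 2) (fun _ _ => sq_nonneg _)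
      (by simpa using hab : (a, b) ∈ Finset.univ.filter
        fun p : Fin (n + 1) × Fin (n + 1) => p.1 < p.2)
  rcases lt_trichotomy a b with h | h | h
  · exact key a b h
  · subst h
    rw [sub_self, abs_zero]
    exact Real.sqrt_nonneg _
  · rw [abs_sub_comm]
    exact key b a h

theorem wedgeNorm_le_norm_mul_norm {n : ℕ} (v w : Coord n) : wedgeNorm v w ≤ ‖v‖ * ‖w‖ := by
  rw [wedgeNorm, wedge_sum_eq]
  refine Real.sqrt_le_iff.mpr ⟨by positivity, ?_⟩
  nlinarith [sq_nonneg (∑ i, v i * w i)]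

theorem wedgeNorm_sub_left {n : ℕ} (v w : Coord n) : wedgeNorm v w = wedgeNorm v (w - v) := by
  simp only [wedgeNorm]
  congr 1
  refine Finset.sum_congr rfl fun p _ => ?_
  simp only [PiLp.sub_apply]
  ring

theorem one_le_norm_affineVec {n : ℕ} (i : Fin (n + 1)) (y : EuclideanSpace ℝ (Fin n)) :
    1 ≤ ‖affineVec i y‖ := by
  have h := PiLp.norm_apply_le (affineVec i y) i
  simpa [affineVec] using h

theorem norm_affineVec_sub {n : ℕ} (i : Fin (n + 1)) (y z : EuclideanSpace ℝ (Fin n)) :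
    ‖affineVec i y - affineVec i z‖ = ‖y - z‖ := by
  simp [EuclideanSpace.norm_eq, Fin.sum_univ_succAbove _ i, affineVec]

/-- One may replace w by w - v in v ∧ w, and affine vectors have norm at least 1. This transfers
Hausdorff-null sets from a chart to projective space. -/
theorem lipschitzWith_affinePoint {n : ℕ} (i : Fin (n + 1)) :
    LipschitzWith 1 (affinePoint i) := by
  refine LipschitzWith.of_dist_le_mul fun y z => ?_
  change projDist _ _ ≤ _
  rw [affinePoint, affinePoint, projDist_mk, wedgeNorm_sub_left]
  have h1 := one_le_norm_affineVec i y
  have h2 := one_le_norm_affineVec i z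
  rw [div_le_iff₀ (by positivity)]
  refine (wedgeNorm_le_norm_mul_norm _ _).trans ?_
  rw [norm_sub_rev, norm_affineVec_sub, NNReal.coe_one, one_mul, dist_eq_norm]
  have := mul_le_mul_of_nonneg_left h2 (mul_nonneg (norm_nonneg (affineVec i y))
    (norm_nonneg (y - z)))
  nlinarith

theorem exists_affinePoint_eq {n : ℕ} (x : RP n) :
    ∃ (i : Fin (n + 1)) (y : EuclideanSpace ℝ (Fin n)), affinePoint i y = x := by
  obtain ⟨i, hi⟩ : ∃ i, x.rep i ≠ 0 := by
    by_contra hc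
    push Not at hc
    exact x.rep_ne_zero (by ext i; simpa using hc i)
  refine ⟨i, WithLp.toLp 2 fun j => x.rep (i.succAbove j) / x.rep i, ?_⟩
  conv_rhs => rw [← x.mk_rep]
  refine (Projectivization.mk_eq_mk_iff' ℝ _ _ _ _).mpr ⟨(x.rep i)⁻¹, ?_⟩
  ext j
  rcases Fin.eq_self_or_eq_succAbove i j with rfl | ⟨j, rfl⟩
  · simp [affineVec, hi]
  · simp [affineVec, div_eq_inv_mul]

theorem norm_le_of_forall_abs_le {n : ℕ} (z : Coord n) {m : ℝ} (h : ∀ a, |z a| ≤ m) :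
    ‖z‖ ≤ (n + 1) * m := by
  have hm : 0 ≤ m := (abs_nonneg _).trans (h 0)
  rw [EuclideanSpace.norm_eq]
  refine Real.sqrt_le_iff.mpr ⟨by positivity, ?_⟩
  calc ∑ i, ‖z i‖ ^ 2 ≤ ∑ _i : Fin (n + 1), m ^ 2 := by
        refine Finset.sum_le_sum fun i _ => ?_
        exact pow_le_pow_left₀ (norm_nonneg _) (h i) 2
    _ = (n + 1) * m ^ 2 := by simp
    _ ≤ ((n + 1) * m) ^ 2 := by
        rw [mul_pow]
        refine mul_le_mul_of_nonneg_right ?_ (sq_nonneg m)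
        have : (0 : ℝ) ≤ n := n.cast_nonneg
        nlinarith

/-- In an affine chart, the projective distance controls the Euclidean distance. -/
theorem norm_inv_smul_sub_le {n : ℕ} {i : Fin (n + 1)} {x v : Coord n} (hx0 : x ≠ 0)
    (hv0 : v ≠ 0) (hx : x i = 1) {K δ : ℝ} (hK : ‖x‖ ≤ K)
    (hd : dist (RP.mk x hx0) (RP.mk v hv0) ≤ δ) (hδ : 2 * ((n + 1) * δ * K) ≤ 1) :
    v i ≠ 0 ∧ ‖(v i)⁻¹ • v - x‖ ≤ 2 * (n + 1) * K ^ 2 * δ := by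
  have hxp : 0 < ‖x‖ := norm_pos_iff.mpr hx0
  have hvp : 0 < ‖v‖ := norm_pos_iff.mpr hv0
  have hδ0 : 0 ≤ δ := dist_nonneg.trans hd
  change projDist _ _ ≤ _ at hd
  rw [projDist_mk, div_le_iff₀ (by positivity)] at hd
  have hw : wedgeNorm x v ≤ δ * K * ‖v‖ := by
    refine hd.trans ?_
    have : δ * (‖x‖ * ‖v‖) ≤ δ * (K * ‖v‖) := by gcongr
    linarith
  -- Since x_i = 1, the coordinates of v - v_i x are minors of x ∧ v.
  have h1 : ‖v - v i • x‖ ≤ (n + 1) * (δ * K * ‖v‖) := by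
    refine norm_le_of_forall_abs_le _ fun a => ?_
    have := (abs_minor_le_wedgeNorm x v i a).trans hw
    rw [hx] at this
    simpa [mul_comm] using this
  -- The smallness of δ makes v - v_i x at most half of v in norm, so v_i cannot be small compared
  -- with v.
  have h2 : ‖v‖ ≤ 2 * (|v i| * K) := by
    have h3 : ‖v‖ ≤ ‖v - v i • x‖ + ‖v i • x‖ := by
      simpa using norm_add_le (v - v i • x) (v i • x)
    have h4 : ‖v i • x‖ ≤ |v i| * K := by
      rw [norm_smul, Real.norm_eq_abs]
      gcongr
    have h5 : 2 * ((n + 1) * δ * K) * ‖v‖ ≤ 1 * ‖v‖ := by gcongr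
    nlinarith
  have hvi : v i ≠ 0 := by
    intro h
    rw [h] at h2
    simp at h2
    exact hv0 h2
  refine ⟨hvi, ?_⟩
  have h6 : (v i)⁻¹ • v - x = (v i)⁻¹ • (v - v i • x) := by
    rw [smul_sub, smul_smul, inv_mul_cancel₀ hvi, one_smul]
  have hvi' : 0 < |v i| := abs_pos.mpr hvi
  have hK0 : 0 ≤ K := hxp.le.trans hK
  rw [h6, norm_smul, norm_inv, Real.norm_eq_abs, inv_mul_le_iff₀ hvi']
  refine h1.trans ?_
  calc (n + 1) * (δ * K * ‖v‖) ≤ (n + 1) * (δ * K * (2 * (|v i| * K))) := by gcongr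
    _ = _ := by ring

/-! ### Integrality of the quadratic form -/

theorem realForm_apply {n : ℕ} (Q : QuadraticForm ℚ (Fin (n + 1) → ℚ)) (v : Fin (n + 1) → ℝ) :
    realForm Q v = ∑ p : Fin (n + 1) × Fin (n + 1), (Q.toMatrix' p.1 p.2 : ℝ) * (v p.1 * v p.2) := by
  rw [Fintype.sum_prod_type]
  simp only [realForm, Matrix.toQuadraticForm', LinearMap.BilinMap.toQuadraticMap_apply,
    Matrix.toLinearMap₂'_apply]
  refine Finset.sum_congr rfl fun i _ => Finset.sum_congr rfl fun j _ => ?_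
  simp
  ring

theorem polar_realForm_apply {n : ℕ} (Q : QuadraticForm ℚ (Fin (n + 1) → ℚ))
    (v w : Fin (n + 1) → ℝ) :
    QuadraticMap.polar (realForm Q) v w = ∑ p : Fin (n + 1) × Fin (n + 1),
      (Q.toMatrix' p.1 p.2 : ℝ) * (v p.1 * w p.2 + w p.1 * v p.2) := by
  simp only [QuadraticMap.polar, realForm_apply, ← Finset.sum_sub_distrib, Pi.add_apply]
  exact Finset.sum_congr rfl fun p _ => by ring

/-- The polar form of a rational quadratic form takes discrete values on integer vectors. -/
theorem exists_polar_gap {n : ℕ} (Q : QuadraticForm ℚ (Fin (n + 1) → ℚ)) :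
    ∃ ε : ℝ, 0 < ε ∧ ∀ v w : Fin (n + 1) → ℤ,
      |QuadraticMap.polar (realForm Q) (fun i => (v i : ℝ)) (fun i => (w i : ℝ))| < ε →
      QuadraticMap.polar (realForm Q) (fun i => (v i : ℝ)) (fun i => (w i : ℝ)) = 0 := by
  -- A common denominator of the matrix of Q: d times the polar form is integral on integer vectors,
  -- so the gap is 1/d.
  set d : ℕ := ∏ p : Fin (n + 1) × Fin (n + 1), (Q.toMatrix' p.1 p.2).den with hd
  have hd0 : 0 < d := Finset.prod_pos fun p _ => Rat.den_pos _
  have hint : ∀ p : Fin (n + 1) × Fin (n + 1), ∃ m : ℤ, (d : ℝ) * (Q.toMatrix' p.1 p.2 : ℝ) = m := by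
    intro p
    obtain ⟨e, he⟩ : (Q.toMatrix' p.1 p.2).den ∣ d :=
      Finset.dvd_prod_of_mem (fun p : Fin (n + 1) × Fin (n + 1) => (Q.toMatrix' p.1 p.2).den)
        (Finset.mem_univ p)
    refine ⟨e * (Q.toMatrix' p.1 p.2).num, ?_⟩
    have h := Rat.mul_den_eq_num (Q.toMatrix' p.1 p.2)
    have h' : (Q.toMatrix' p.1 p.2 : ℝ) * ((Q.toMatrix' p.1 p.2).den : ℝ)
        = ((Q.toMatrix' p.1 p.2).num : ℝ) := by exact_mod_cast h
    rw [he]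
    push_cast
    rw [← h']
    ring
  choose m hm using hint
  refine ⟨(d : ℝ)⁻¹, by positivity, fun v w h => ?_⟩
  set P := QuadraticMap.polar (realForm Q) (fun i => (v i : ℝ)) (fun i => (w i : ℝ)) with hP
  have hPz : (d : ℝ) * P
      = ((∑ p, m p * (v p.1 * w p.2 + w p.1 * v p.2) : ℤ) : ℝ) := by
    rw [hP, polar_realForm_apply, Finset.mul_sum]
    push_cast
    refine Finset.sum_congr rfl fun p _ => ?_
    rw [← mul_assoc, hm]
  have hd' : (0 : ℝ) < d := by exact_mod_cast hd0
  have h1 : |(d : ℝ) * P| < 1 := by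
    rw [abs_mul, abs_of_pos hd']
    calc (d : ℝ) * |P| < d * (d : ℝ)⁻¹ := by gcongr
      _ = 1 := mul_inv_cancel₀ hd'.ne'
  rw [hPz, ← Int.cast_abs] at h1
  have h2 : (∑ p, m p * (v p.1 * w p.2 + w p.1 * v p.2) : ℤ) = 0 :=
    Int.abs_lt_one_iff.mp (by exact_mod_cast h1)
  rw [h2, Int.cast_zero] at hPz
  exact (mul_eq_zero.mp hPz).resolve_left hd'.ne'

theorem exists_abs_realForm_le {n : ℕ} (Q : QuadraticForm ℚ (Fin (n + 1) → ℚ)) :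
    ∃ C : ℝ, 0 < C ∧ ∀ z : Coord n, |realForm Q z.ofLp| ≤ C * ‖z‖ ^ 2 := by
  refine ⟨1 + ∑ p : Fin (n + 1) × Fin (n + 1), |(Q.toMatrix' p.1 p.2 : ℝ)|,
    add_pos_of_pos_of_nonneg one_pos (Finset.sum_nonneg fun _ _ => abs_nonneg _), fun z => ?_⟩
  rw [realForm_apply, add_mul, Finset.sum_mul]
  refine (Finset.abs_sum_le_sum_abs _ _).trans ?_
  have : ∑ p : Fin (n + 1) × Fin (n + 1), |(Q.toMatrix' p.1 p.2 : ℝ) * (z p.1 * z p.2)|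
      ≤ ∑ p : Fin (n + 1) × Fin (n + 1), |(Q.toMatrix' p.1 p.2 : ℝ)| * ‖z‖ ^ 2 := by
    refine Finset.sum_le_sum fun p _ => ?_
    rw [abs_mul, abs_mul, sq]
    have h1 : |z p.1| ≤ ‖z‖ := PiLp.norm_apply_le z p.1
    have h2 : |z p.2| ≤ ‖z‖ := PiLp.norm_apply_le z p.2
    gcongr
  have h2 : 0 ≤ 1 * ‖z‖ ^ 2 := by positivity
  linarith

theorem realForm_toReal_eq_zero {n : ℕ} {Q : QuadraticForm ℚ (Fin (n + 1) → ℚ)}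
    {v : PrimitiveVector n} (hv : v.point ∈ quadric Q) : realForm Q v.toReal.ofLp = 0 := by
  obtain ⟨w, hw, h, hQ⟩ := hv
  obtain ⟨a, ha⟩ := (Projectivization.mk_eq_mk_iff' ℝ _ _ _ _).mp h
  rw [← ha, WithLp.ofLp_smul, QuadraticMap.map_smul, hQ, smul_zero]

/-- The polar form of two isotropic vectors, in terms of the form at a difference of multiples. -/
theorem polar_eq_neg_mul {n : ℕ} {Q : QuadraticForm ℚ (Fin (n + 1) → ℚ)} {v w : Coord n}
    (hv : realForm Q v.ofLp = 0) (hw : realForm Q w.ofLp = 0) {a b : ℝ} (ha : a ≠ 0) (hb : b ≠ 0) :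
    QuadraticMap.polar (realForm Q) v.ofLp w.ofLp
      = -(a * b * realForm Q (a⁻¹ • v - b⁻¹ • w).ofLp) := by
  have h : (a⁻¹ • v - b⁻¹ • w).ofLp = a⁻¹ • v.ofLp + (-b⁻¹) • w.ofLp := by
    simp [sub_eq_add_neg]
  rw [h, QuadraticMap.map_add (realForm Q), QuadraticMap.map_smul, QuadraticMap.map_smul, hv, hw,
    QuadraticMap.polar_smul_left, QuadraticMap.polar_smul_right]
  simp only [smul_eq_mul, mul_zero, zero_add]
  field_simp

/-! ### Totally isotropic rational subspaces -/

/-- Orthogonality extends bilinearly from S to its span, and the polar form at (x, x) is 2 Q(x), so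
the span is totally isotropic. -/
theorem finrank_span_le_rationalRank {n : ℕ} {Q : QuadraticForm ℚ (Fin (n + 1) → ℚ)}
    {S : Set (PrimitiveVector n)} (hS : ∀ v ∈ S, ∀ w ∈ S,
      QuadraticMap.polar (realForm Q) v.toReal.ofLp w.toReal.ofLp = 0) :
    Module.finrank ℝ (Submodule.span ℝ ((fun v : PrimitiveVector n => v.toReal.ofLp) '' S))
      ≤ rationalRank Q := by
  -- A supremum in ℕ is meaningful only for a bounded set; dimensions are at most n + 1.
  refine le_csSup ⟨n + 1, ?_⟩ ⟨_, ⟨(fun v i => (v.1 i : ℚ)) '' S, ?_⟩, ?_, rfl⟩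
  · rintro d ⟨E, -, -, rfl⟩
    simpa using Submodule.finrank_le E
  · rw [Set.image_image]
    congr 1
  · intro x hx
    have h : (realForm Q).polarBilin x x = 0 := by
      refine Submodule.span_induction₂
        (p := fun x y _ _ => (realForm Q).polarBilin x y = 0) ?_ ?_ ?_ ?_ ?_ ?_ ?_ hx hx
      · rintro _ _ ⟨v, hv, rfl⟩ ⟨w, hw, rfl⟩
        exact hS v hv w hw
      · simp
      · simp
      · intro x y z _ _ _ h1 h2
        rw [map_add, LinearMap.add_apply, h1, h2, add_zero]
      · intro x y z _ _ _ h1 h2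
        rw [map_add, h1, h2, add_zero]
      · intro r x y _ _ h1
        rw [map_smul, LinearMap.smul_apply, h1, smul_zero]
      · intro r x y _ _ h1
        rw [map_smul, h1, smul_zero]
    rw [QuadraticMap.polarBilin_apply_apply, QuadraticMap.polar_self] at h
    simpa using h

/-- A direction `s` in a space of dimension at least the rational rank, whose image under `A`
has constant inner product with the given orthogonal isotropic points of an affine chart. -/
theorem exists_direction_inner_const {n : ℕ} {Q : QuadraticForm ℚ (Fin (n + 1) → ℚ)}
    {W : Type*} [NormedAddCommGroup W] [NormedSpace ℝ W] [FiniteDimensional ℝ W]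
    (hW : rationalRank Q ≤ Module.finrank ℝ W) (A : W →L[ℝ] Coord n) {i : Fin (n + 1)}
    {S : Set (PrimitiveVector n)} (hne : S.Nonempty) (hSi : ∀ v ∈ S, v.toReal i ≠ 0)
    (hS : ∀ v ∈ S, ∀ w ∈ S,
      QuadraticMap.polar (realForm Q) v.toReal.ofLp w.toReal.ofLp = 0) :
    ∃ (s : W) (c : ℝ), ‖s‖ = 1 ∧ ∀ v ∈ S, inner ℝ (A s) ((v.toReal i)⁻¹ • v.toReal) = c := by
  set E := Submodule.span ℝ ((fun v : PrimitiveVector n => v.toReal.ofLp) '' S) with hE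
  have hmem : ∀ v ∈ S, v.toReal.ofLp ∈ E := fun v hv => Submodule.subset_span ⟨v, hv, rfl⟩
  -- D contains the differences of the normalised points v/v_i. It is a proper subspace of E because
  -- v₀ has nonzero i-th coordinate, and this gain of one dimension is what makes k ≥ rk_ℚ X
  -- sufficient.
  set D : Submodule ℝ (Fin (n + 1) → ℝ) := E ⊓ (LinearMap.proj i : (Fin (n + 1) → ℝ) →ₗ[ℝ] ℝ).ker
    with hD
  obtain ⟨v₀, hv₀⟩ := hne
  have hlt : D < E := by
    refine lt_of_le_of_ne inf_le_left fun h => hSi v₀ hv₀ ?_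
    have h1 : v₀.toReal.ofLp ∈ D := h ▸ hmem v₀ hv₀
    exact h1.2
  have hfin : Module.finrank ℝ (Module.Dual ℝ D) < Module.finrank ℝ W := by
    rw [Subspace.dual_finrank_eq]
    exact (Submodule.finrank_lt_finrank_of_lt hlt).trans_le
      ((finrank_span_le_rationalRank hS).trans hW)
  -- T sends s to the functional ⟨A s, ·⟩ on D; dim D < dim W forces a nonzero kernel.
  let T : W →ₗ[ℝ] Module.Dual ℝ D :=
    (((dotProductBilin ℝ ℝ : (Fin (n + 1) → ℝ) →ₗ[ℝ] (Fin (n + 1) → ℝ) →ₗ[ℝ] ℝ).compl₂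
      D.subtype).comp (WithLp.linearEquiv 2 ℝ (Fin (n + 1) → ℝ)).toLinearMap).comp A.toLinearMap
  obtain ⟨s, hs, hs0⟩ := Submodule.exists_mem_ne_zero_of_ne_bot
    (LinearMap.ker_ne_bot_of_finrank_lt (f := T) hfin)
  have hT : ∀ z : Coord n, z.ofLp ∈ D → inner ℝ (A s) z = 0 := by
    intro z hz
    have h1 : T s ⟨z.ofLp, hz⟩ = 0 := by rw [LinearMap.mem_ker.mp hs]; rfl
    rw [real_inner_comm]
    exact h1
  refine ⟨‖s‖⁻¹ • s, inner ℝ (A (‖s‖⁻¹ • s)) ((v₀.toReal i)⁻¹ • v₀.toReal), ?_, fun v hv => ?_⟩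
  · rw [norm_smul, norm_inv, norm_norm, inv_mul_cancel₀ (norm_ne_zero_iff.mpr hs0)]
  · rw [← sub_eq_zero, ← inner_sub_right, map_smul, inner_smul_left, hT, mul_zero]
    refine ⟨E.sub_mem (E.smul_mem _ (hmem v hv)) (E.smul_mem _ (hmem v₀ hv₀)), ?_⟩
    have h1 := hSi v hv
    have h2 := hSi v₀ hv₀
    simp [h1, h2]

/-- Ensures that W is nontrivial as soon as X has a rational point, so that single parameters are
null. -/
theorem one_le_rationalRank {n : ℕ} {Q : QuadraticForm ℚ (Fin (n + 1) → ℚ)}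
    {v : PrimitiveVector n} (hv : v.point ∈ quadric Q) : 1 ≤ rationalRank Q := by
  have h := finrank_span_le_rationalRank (Q := Q) (S := {v}) (by
    rintro _ rfl _ rfl
    rw [QuadraticMap.polar_self, realForm_toReal_eq_zero hv, smul_zero])
  rw [Set.image_singleton, finrank_span_singleton] at h
  · exact h
  · intro h0
    refine v.toReal_ne_zero ?_
    ext i
    exact congrFun h0 i

/-! ### Heights -/

theorem PrimitiveVector.abs_apply_le_height {n : ℕ} (v : PrimitiveVector n) (i : Fin (n + 1)) :
    |v.toReal i| ≤ v.height := by
  have h : (v.1 i).natAbs ≤ v.height := Finset.le_sup (f := fun i => (v.1 i).natAbs)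
    (Finset.mem_univ i)
  have : ((v.1 i).natAbs : ℝ) ≤ v.height := by exact_mod_cast h
  simpa [PrimitiveVector.toReal, Nat.cast_natAbs] using this

theorem PrimitiveVector.one_le_height {n : ℕ} (v : PrimitiveVector n) : 1 ≤ v.height := by
  by_contra h
  refine v.toReal_ne_zero ?_
  ext i
  have h1 := v.abs_apply_le_height i
  rw [Nat.lt_one_iff.mp (not_le.mp h), Nat.cast_zero] at h1
  simpa using abs_nonpos_iff.mp h1

theorem PrimitiveVector.finite_height_lt {n : ℕ} (N : ℕ) :
    {v : PrimitiveVector n | v.height < N}.Finite := by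
  refine Set.Finite.of_finite_image
    (f := fun v : PrimitiveVector n => (v.1 : Fin (n + 1) → ℤ)) ?_ ?_
  · refine (Set.finite_Icc (fun _ => -(N : ℤ)) (fun _ => (N : ℤ))).subset ?_
    rintro _ ⟨v, hv, rfl⟩
    have h : ∀ i, (v.1 i).natAbs < N := fun i =>
      (Finset.le_sup (f := fun i => (v.1 i).natAbs) (Finset.mem_univ i)).trans_lt hv
    constructor <;> intro i <;> have := h i <;> simp only <;> omega
  · intro v _ w _ h
    exact Subtype.ext h

instance {n : ℕ} : Countable (PrimitiveVector n) := by
  unfold PrimitiveVector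
  infer_instance

/-! ### Measure estimates -/

/-- A set on which `g` varies by at most `2ε`, where `g` is expansive in the direction `s`, has
pairwise disjoint translates by multiples of `δ • s`. -/
theorem nsmul_measure_slab_le {W : Type*} [NormedAddCommGroup W] [NormedSpace ℝ W]
    [MeasurableSpace W] [BorelSpace W] (μ : Measure W) [μ.IsAddLeftInvariant]
    {g : W → ℝ} {s q : W} {U S : Set W} {c c₁ ε δ r : ℝ} (hs : ‖s‖ = 1)
    (hg : ∀ t ∈ U, ∀ τ : ℝ, 0 ≤ τ → t + τ • s ∈ U → c₁ * τ ≤ g (t + τ • s) - g t)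
    (hSU : S ⊆ U) (hSr : S ⊆ Metric.closedBall q r) (hSm : MeasurableSet S)
    (hSc : ∀ t ∈ S, |g t - c| ≤ ε) (hc₁ : 0 < c₁) (hδ : 0 < δ) (hεδ : 2 * ε < c₁ * δ) (N : ℕ) :
    N * μ S ≤ μ (Metric.closedBall q (r + N * δ)) := by
  let T : ℕ → Set W := fun j => (fun t => (-((j * δ) • s)) + t) ⁻¹' S
  have hT : ∀ j, MeasurableSet (T j) := fun j => hSm.preimage (by fun_prop)
  have hμT : ∀ j, μ (T j) = μ S := fun j => measure_preimage_add μ _ S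
  -- A common point would give two points of S differing by (j - i)δ in direction s; between them g
  -- grows by at least c₁δ > 2ε, more than its variation on S.
  have hlt : ∀ i j : ℕ, i < j → Disjoint (T i) (T j) := by
    intro i j hij
    rw [Set.disjoint_left]
    intro t hi hj
    have hτ : (1 : ℝ) ≤ (j : ℝ) - i := by
      have : (i : ℝ) + 1 ≤ j := by exact_mod_cast hij
      linarith
    have h0 : 0 ≤ ((j : ℝ) - i) * δ := mul_nonneg (by linarith) hδ.le
    have e : -((i * δ) • s) + t = (-((j * δ) • s) + t) + (((j : ℝ) - i) * δ) • s := by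
      module
    have hi' : -((i * δ) • s) + t ∈ S := hi
    have hj' : -((j * δ) • s) + t ∈ S := hj
    have h1 := hg _ (hSU hj') _ h0 (e ▸ hSU hi')
    rw [← e] at h1
    have h2 := abs_le.mp (hSc _ hi')
    have h3 := abs_le.mp (hSc _ hj')
    have h4 : c₁ * δ * 1 ≤ c₁ * δ * ((j : ℝ) - i) := by gcongr
    nlinarith [h2.1, h2.2, h3.1, h3.2]
  have hdisj : Set.PairwiseDisjoint (↑(Finset.range N)) T := by
    intro i _ j _ hij
    rcases lt_or_gt_of_ne hij with h | h
    · exact hlt i j h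
    · exact (hlt j i h).symm
  have hsub : ⋃ j ∈ Finset.range N, T j ⊆ Metric.closedBall q (r + N * δ) := by
    intro t ht
    simp only [Set.mem_iUnion, Finset.mem_range] at ht
    obtain ⟨j, hj, ht⟩ := ht
    have ht' : -((j * δ) • s) + t ∈ S := ht
    have h1 := hSr ht'
    rw [Metric.mem_closedBall, dist_eq_norm] at h1 ⊢
    have h2 : ‖(j * δ) • s‖ = j * δ := by
      rw [norm_smul, hs, mul_one, Real.norm_of_nonneg (by positivity)]
    have h3 : t - q = (-((j * δ) • s) + t - q) + (j * δ) • s := by abel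
    have h4 : (j : ℝ) * δ ≤ N * δ := by
      have : (j : ℝ) ≤ N := by exact_mod_cast hj.le
      gcongr
    rw [h3]
    refine (norm_add_le _ _).trans ?_
    linarith
  calc N * μ S = ∑ j ∈ Finset.range N, μ (T j) := by simp [hμT]
    _ = μ (⋃ j ∈ Finset.range N, T j) :=
        (measure_biUnion_finset hdisj fun j _ => hT j).symm
    _ ≤ _ := measure_mono hsub

/-- The measure of a slab of width comparable with `δ` in a ball of radius `5 ρ`. -/
theorem measure_slab_le {W : Type*} [NormedAddCommGroup W] [NormedSpace ℝ W]
    [FiniteDimensional ℝ W] [MeasurableSpace W] [BorelSpace W] (μ : Measure W) [μ.IsAddHaarMeasure]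
    {g : W → ℝ} {s q : W} {U S : Set W} {c c₁ ε δ ρ : ℝ} (hs : ‖s‖ = 1)
    (hg : ∀ t ∈ U, ∀ τ : ℝ, 0 ≤ τ → t + τ • s ∈ U → c₁ * τ ≤ g (t + τ • s) - g t)
    (hSU : S ⊆ U) (hSr : S ⊆ Metric.closedBall q (5 * ρ)) (hSm : MeasurableSet S)
    (hSc : ∀ t ∈ S, |g t - c| ≤ ε) (hc₁ : 0 < c₁) (hδ : 0 < δ) (hεδ : 2 * ε < c₁ * δ)
    (hδρ : δ ≤ ρ) :
    μ S ≤ ENNReal.ofReal (2 * 6 ^ Module.finrank ℝ W * (δ / ρ)) * μ (Metric.closedBall q ρ) := by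
  have hρ : 0 < ρ := hδ.trans_le hδρ
  -- N translates move by at most ρ, so they stay in the ball of radius 6ρ, whence the factor 6^dim.
  -- As N ≥ 1, rounding down costs at most a factor 2.
  set N := ⌊ρ / δ⌋₊ with hN
  have h1 : (N : ℝ) ≤ ρ / δ := Nat.floor_le (by positivity)
  have h2 : ρ / δ < N + 1 := Nat.lt_floor_add_one _
  have h3 : (1 : ℝ) ≤ N := by
    have : 1 ≤ N := Nat.le_floor (by rw [Nat.cast_one, le_div_iff₀ hδ]; linarith)
    exact_mod_cast this
  have h4 : (N : ℝ) * δ ≤ ρ := by rwa [le_div_iff₀ hδ] at h1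
  have h5 : (1 : ℝ) ≤ N * (2 * (δ / ρ)) := by
    have h6 : ρ / δ ≤ 2 * N := by linarith
    have h7 : ρ / δ * (δ / ρ) = 1 := by field_simp
    calc (1 : ℝ) = ρ / δ * (δ / ρ) := h7.symm
      _ ≤ 2 * N * (δ / ρ) := by gcongr
      _ = _ := by ring
  have h6 := nsmul_measure_slab_le μ hs hg hSU hSr hSm hSc hc₁ hδ hεδ N
  have h7 : μ (Metric.closedBall q (5 * ρ + N * δ))
      ≤ ENNReal.ofReal (6 ^ Module.finrank ℝ W) * μ (Metric.closedBall q ρ) := by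
    rw [addHaar_closedBall_center μ q ρ,
      ← addHaar_closedBall_mul μ q (by norm_num : (0 : ℝ) ≤ 6) hρ.le]
    exact measure_mono (Metric.closedBall_subset_closedBall (by linarith))
  calc μ S = ENNReal.ofReal 1 * μ S := by simp
    _ ≤ ENNReal.ofReal (N * (2 * (δ / ρ))) * μ S := by gcongr
    _ = ENNReal.ofReal (2 * (δ / ρ)) * (N * μ S) := by
        rw [ENNReal.ofReal_mul (by positivity), ENNReal.ofReal_natCast]
        ring
    _ ≤ ENNReal.ofReal (2 * (δ / ρ)) *
          (ENNReal.ofReal (6 ^ Module.finrank ℝ W) * μ (Metric.closedBall q ρ)) := by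
        exact mul_le_mul' le_rfl (h6.trans h7)
    _ = _ := by
        rw [← mul_assoc, ← ENNReal.ofReal_mul (by positivity)]
        congr 2
        ring

/-- A local density bound at scale `ρ` gives a global measure bound. -/
theorem measure_le_of_forall_ball {W : Type*} [NormedAddCommGroup W] [NormedSpace ℝ W]
    [FiniteDimensional ℝ W] [MeasurableSpace W] [BorelSpace W] (μ : Measure W)
    {p : W} {R ρ : ℝ} {B : Set W} {θ : ENNReal} (hρ : 0 < ρ) (hρ1 : ρ ≤ 1)
    (hB : B ⊆ Metric.closedBall p R)
    (h : ∀ q ∈ Metric.closedBall p R,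
      μ (B ∩ Metric.closedBall q (5 * ρ)) ≤ θ * μ (Metric.closedBall q ρ)) :
    μ B ≤ θ * μ (Metric.closedBall p (R + 1)) := by
  -- The selected ρ-balls are disjoint, while their fivefold enlargements cover; this is the origin
  -- of the radius 5ρ in the local bounds.
  obtain ⟨u, huR, hu, hcov⟩ := Vitali.exists_disjoint_subfamily_covering_enlargement_closedBall
    (Metric.closedBall p R) (fun q : W => q) (fun _ => ρ) ρ (fun _ _ => le_rfl) 5 (by norm_num)
  have hcount : u.Countable := hu.countable_of_nonempty_interior fun q _ =>
    ⟨q, Metric.ball_subset_interior_closedBall (Metric.mem_ball_self hρ)⟩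
  have hsub : B ⊆ ⋃ q ∈ u, B ∩ Metric.closedBall q (5 * ρ) := by
    intro t ht
    obtain ⟨q, hq, hq'⟩ := hcov t (hB ht)
    exact Set.mem_biUnion hq ⟨ht, hq' (Metric.mem_closedBall_self hρ.le)⟩
  calc μ B ≤ ∑' q : u, μ (B ∩ Metric.closedBall (q : W) (5 * ρ)) :=
        (measure_mono hsub).trans (measure_biUnion_le μ hcount _)
    _ ≤ ∑' q : u, θ * μ (Metric.closedBall (q : W) ρ) :=
        ENNReal.tsum_le_tsum fun q => h q (huR q.2)
    _ = θ * μ (⋃ q ∈ u, Metric.closedBall q ρ) := by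
        rw [ENNReal.tsum_mul_left, measure_biUnion hcount hu
          fun q _ => Metric.isClosed_closedBall.measurableSet]
    _ ≤ _ := by
        gcongr
        refine Set.iUnion₂_subset fun q hq => Metric.closedBall_subset_closedBall' ?_
        have := huR hq
        rw [Metric.mem_closedBall] at this
        linarith

/-! ### Points near rational points of a given size -/

/-- The parameters `t ∈ U` for which `[F t]` is within `δ` of a rational point of the quadric with
height in `[h, 2h)`. -/
def nearRational {n : ℕ} (Q : QuadraticForm ℚ (Fin (n + 1) → ℚ)) {W : Type*} (f : W → RP n)
    (U : Set W) (h δ : ℝ) : Set W :=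
  {t ∈ U | ∃ v : PrimitiveVector n, v.point ∈ quadric Q ∧ h ≤ v.height ∧ v.height < 2 * h ∧
    dist (f t) v.point < δ}

/-- In `polar_eq_neg_mul` the two coordinates are at most 2h and the form is at most Cη², which puts
the polar value below the gap ε. -/
theorem polar_eq_zero_of_near {n : ℕ} {Q : QuadraticForm ℚ (Fin (n + 1) → ℚ)} {i : Fin (n + 1)}
    {C ε h η : ℝ} (hC : ∀ z : Coord n, |realForm Q z.ofLp| ≤ C * ‖z‖ ^ 2)
    (hε : ∀ v w : Fin (n + 1) → ℤ,
      |QuadraticMap.polar (realForm Q) (fun i => (v i : ℝ)) (fun i => (w i : ℝ))| < ε →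
      QuadraticMap.polar (realForm Q) (fun i => (v i : ℝ)) (fun i => (w i : ℝ)) = 0)
    (hη : 4 * h ^ 2 * (C * η ^ 2) < ε) (hC0 : 0 ≤ C) {v w : PrimitiveVector n}
    (hv : v.point ∈ quadric Q) (hw : w.point ∈ quadric Q) (hvi : v.toReal i ≠ 0)
    (hwi : w.toReal i ≠ 0) (hvh : v.height < 2 * h) (hwh : w.height < 2 * h)
    (hvw : ‖(v.toReal i)⁻¹ • v.toReal - (w.toReal i)⁻¹ • w.toReal‖ ≤ η) :
    QuadraticMap.polar (realForm Q) v.toReal.ofLp w.toReal.ofLp = 0 := by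
  refine hε v.1 w.1 ?_
  change |QuadraticMap.polar (realForm Q) v.toReal.ofLp w.toReal.ofLp| < ε
  rw [polar_eq_neg_mul (realForm_toReal_eq_zero hv) (realForm_toReal_eq_zero hw) hvi hwi, abs_neg,
    abs_mul, abs_mul]
  refine lt_of_le_of_lt ?_ hη
  have h1 := (v.abs_apply_le_height i).trans hvh.le
  have h2 := (w.abs_apply_le_height i).trans hwh.le
  have h3 : |realForm Q ((v.toReal i)⁻¹ • v.toReal - (w.toReal i)⁻¹ • w.toReal).ofLp|
      ≤ C * η ^ 2 := (hC _).trans (by gcongr)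
  calc _ ≤ (2 * h) * (2 * h) * (C * η ^ 2) := by
        have : 0 ≤ 2 * h := (abs_nonneg _).trans h1
        gcongr
    _ = _ := by ring

/-- The rational points seen from the ball are pairwise orthogonal, so a linear functional g of the
chart point is almost constant on the set, yet expanding along s. In `hη`, the chart distance e =
2(n+1)K²δ to a rational point enters twice, and the other term is the displacement over a diameter
10ρ. -/
theorem measure_nearRational_inter_ball_le {n : ℕ} {Q : QuadraticForm ℚ (Fin (n + 1) → ℚ)}
    {W : Type*} [NormedAddCommGroup W] [NormedSpace ℝ W] [FiniteDimensional ℝ W]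
    [MeasurableSpace W] [BorelSpace W] (μ : Measure W) [μ.IsAddHaarMeasure]
    (hW : rationalRank Q ≤ Module.finrank ℝ W) {i : Fin (n + 1)}
    {f : W → EuclideanSpace ℝ (Fin n)} {A : W →L[ℝ] Coord n} {κ : NNReal} (hκ : 0 < κ)
    (hA : ∀ s, 2 * κ * ‖s‖ ≤ ‖A s‖) {p : W} {R : ℝ}
    (hF : ApproximatesLinearOn (fun t => affineVec i (f t)) A (Metric.closedBall p R) κ)
    {K : ℝ} (hK : ∀ t ∈ Metric.closedBall p R, ‖affineVec i (f t)‖ ≤ K)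
    {C ε : ℝ} (hC : ∀ z : Coord n, |realForm Q z.ofLp| ≤ C * ‖z‖ ^ 2) (hC0 : 0 ≤ C)
    (hε : ∀ v w : Fin (n + 1) → ℤ,
      |QuadraticMap.polar (realForm Q) (fun i => (v i : ℝ)) (fun i => (w i : ℝ))| < ε →
      QuadraticMap.polar (realForm Q) (fun i => (v i : ℝ)) (fun i => (w i : ℝ)) = 0)
    {h δ ρ : ℝ} (hδ : 0 < δ) (hKδ : 2 * ((n + 1) * δ * K) ≤ 1)
    (hη : 4 * h ^ 2 * (C * (2 * (2 * (n + 1) * K ^ 2 * δ) + 10 * (‖A‖ + κ) * ρ) ^ 2) < ε)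
    (hδρ : 3 * (2 * (n + 1) * K ^ 2 * δ) / κ ≤ ρ) (q : W) :
    μ (nearRational Q (fun t => affinePoint i (f t)) (Metric.closedBall p R) h δ ∩
        Metric.closedBall q (5 * ρ))
      ≤ ENNReal.ofReal (2 * 6 ^ Module.finrank ℝ W * (3 * (2 * (n + 1) * K ^ 2 * δ) / κ / ρ))
        * μ (Metric.closedBall q ρ) := by
  set U := Metric.closedBall p R with hU
  set F : W → Coord n := fun t => affineVec i (f t) with hFdef
  set e : ℝ := 2 * (n + 1) * K ^ 2 * δ with he
  have hκ' : (0 : ℝ) < κ := hκ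
  set B := nearRational Q (fun t => affinePoint i (f t)) U h δ ∩ Metric.closedBall q (5 * ρ)
    with hB
  rcases B.eq_empty_or_nonempty with hBe | ⟨t₀, ht₀⟩
  · rw [hBe, measure_empty]
    exact zero_le
  have hK0 : 0 < K := one_pos.trans_le
    ((one_le_norm_affineVec i _).trans (hK t₀ ht₀.1.1))
  have he0 : 0 < e := by positivity
  have hLip : ∀ t ∈ U, ∀ t' ∈ U, ‖F t - F t'‖ ≤ (‖A‖ + κ) * ‖t - t'‖ := by
    intro t ht t' ht'
    have h1 := hF t ht t' ht'
    have h2 := A.le_opNorm (t - t')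
    have h3 : F t - F t' = (F t - F t' - A (t - t')) + A (t - t') := by abel
    rw [h3]
    refine (norm_add_le _ _).trans ?_
    linarith
  let S : Set (PrimitiveVector n) := {v | v.point ∈ quadric Q ∧ v.height < 2 * h ∧
    ∃ t ∈ U ∩ Metric.closedBall q (5 * ρ), dist (affinePoint i (f t)) v.point < δ}
  have hnear : ∀ v : PrimitiveVector n, ∀ t ∈ U, dist (affinePoint i (f t)) v.point < δ →
      v.toReal i ≠ 0 ∧ ‖(v.toReal i)⁻¹ • v.toReal - F t‖ ≤ e := fun v t ht hd =>
    norm_inv_smul_sub_le (affineVec_ne_zero i (f t)) v.toReal_ne_zero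
      (by simp [affineVec]) (hK t ht) hd.le hKδ
  have hSi : ∀ v ∈ S, v.toReal i ≠ 0 := by
    rintro v ⟨-, -, t, ht, hd⟩
    exact (hnear v t ht.1 hd).1
  have hS : ∀ v ∈ S, ∀ w ∈ S,
      QuadraticMap.polar (realForm Q) v.toReal.ofLp w.toReal.ofLp = 0 := by
    intro v hv w hw
    have hvi := hSi v hv
    have hwi := hSi w hw
    obtain ⟨hvQ, hvh, t, ht, hd⟩ := hv
    obtain ⟨hwQ, hwh, t', ht', hd'⟩ := hw
    refine polar_eq_zero_of_near hC hε hη hC0 hvQ hwQ hvi hwi hvh hwh ?_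
    have h1 := (hnear v t ht.1 hd).2
    have h2 := (hnear w t' ht'.1 hd').2
    have h3 := hLip t ht.1 t' ht'.1
    have h4 : ‖t - t'‖ ≤ 10 * ρ := by
      rw [← dist_eq_norm]
      have h5 := ht.2
      have h6 := ht'.2
      rw [Metric.mem_closedBall] at h5 h6
      linarith [dist_triangle_right t t' q]
    have h5 : (‖A‖ + κ) * ‖t - t'‖ ≤ (‖A‖ + κ) * (10 * ρ) := by gcongr
    have h6 : (v.toReal i)⁻¹ • v.toReal - (w.toReal i)⁻¹ • w.toReal
        = ((v.toReal i)⁻¹ • v.toReal - F t) + (F t - F t')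
          - ((w.toReal i)⁻¹ • w.toReal - F t') := by abel
    rw [h6]
    refine (norm_sub_le _ _).trans ((add_le_add_left (norm_add_le _ _) _).trans ?_)
    linarith
  have hSne : S.Nonempty := by
    obtain ⟨⟨ht, v, hv, -, hvh, hd⟩, htq⟩ := ht₀
    exact ⟨v, hv, hvh, t₀, ⟨ht, htq⟩, hd⟩
  obtain ⟨s, c, hs, hc⟩ := exists_direction_inner_const hW A hSne hSi hS
  have hAs : 2 * κ ≤ ‖A s‖ := by simpa [hs] using hA s
  have hAs0 : 0 < ‖A s‖ := lt_of_lt_of_le (by positivity) hAs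
  set g : W → ℝ := fun t => inner ℝ (A s) (F t) with hg
  have hgc : ContinuousOn g U := by
    have := hF.continuousOn
    exact continuousOn_const.inner this
  set T : Set W := (U ∩ Metric.closedBall q (5 * ρ)) ∩
    g ⁻¹' (Metric.closedBall c (‖A s‖ * e)) with hT
  -- The enclosing slab is closed, hence measurable; measurability of B itself is never needed.
  have hTc : IsClosed T := (hgc.mono Set.inter_subset_left).preimage_isClosed_of_isClosed
    (Metric.isClosed_closedBall.inter Metric.isClosed_closedBall) Metric.isClosed_closedBall
  have hBT : B ⊆ T := by
    rintro t ⟨⟨ht, v, hv, -, hvh, hd⟩, htq⟩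
    refine ⟨⟨ht, htq⟩, ?_⟩
    have h1 := hc v ⟨hv, hvh, t, ⟨ht, htq⟩, hd⟩
    have h2 := (hnear v t ht hd).2
    rw [Set.mem_preimage, Metric.mem_closedBall, dist_comm, Real.dist_eq, ← h1, hg,
      ← inner_sub_right]
    refine (abs_real_inner_le_norm _ _).trans ?_
    gcongr
  refine (measure_mono hBT).trans (measure_slab_le μ (g := g) (U := U) (c := c)
    (c₁ := κ * ‖A s‖) (ε := ‖A s‖ * e) hs ?_ (fun t ht => ht.1.1) (fun t ht => ht.1.2)
    hTc.measurableSet (fun t ht => ?_) (by positivity) (by positivity) ?_ hδρ)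
  -- The linear part contributes τ‖A s‖² ≥ 2κτ‖A s‖ and the error at most κτ‖A s‖.
  · intro t ht τ hτ ht'
    have h1 := hF _ ht' t ht
    rw [add_sub_cancel_left, map_smul, norm_smul, hs, mul_one, Real.norm_of_nonneg hτ] at h1
    have h2 : g (t + τ • s) - g t = τ * ‖A s‖ ^ 2
        + inner ℝ (A s) (F (t + τ • s) - F t - τ • A s) := by
      rw [hg]
      simp only [inner_sub_right, inner_smul_right, real_inner_self_eq_norm_sq]
      ring
    have h3 := neg_le_of_abs_le (abs_real_inner_le_norm (A s) (F (t + τ • s) - F t - τ • A s))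
    have h4 : ‖A s‖ * ‖F (t + τ • s) - F t - τ • A s‖ ≤ ‖A s‖ * (κ * τ) := by
      gcongr
    have h5 : (τ * ‖A s‖) * (2 * κ) ≤ (τ * ‖A s‖) * ‖A s‖ := by gcongr
    rw [h2]
    nlinarith
  · have := ht.2
    rwa [Set.mem_preimage, Metric.mem_closedBall, Real.dist_eq] at this
  -- With step 3e/κ the required inequality reads 2‖A s‖e < 3‖A s‖e.
  · field_simp
    norm_num

/-! ### Points that are not too well approximable -/

/-- `x` satisfies `dist (x, v) ≥ c H(v)^(-b)` for some `c > 0` and all rational points `v` of the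
quadric. -/
def IsBadlyApproximable {n : ℕ} (Q : QuadraticForm ℚ (Fin (n + 1) → ℚ)) (b : ℝ) (x : RP n) :
    Prop :=
  ∃ c : ℝ, 0 < c ∧ ∀ v : PrimitiveVector n, v.point ∈ quadric Q →
    c * (v.height : ℝ) ^ (-b) ≤ dist x v.point

/-- Restricting c to 1/(m+1) gives a countable union of closed sets. Measurability lets an
almost-everywhere statement for the restricted measure be read off from a null subset of M. -/
theorem measurableSet_isBadlyApproximable {n : ℕ} (Q : QuadraticForm ℚ (Fin (n + 1) → ℚ))
    (b : ℝ) : MeasurableSet {x : RP n | IsBadlyApproximable Q b x} := by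
  have h : {x : RP n | IsBadlyApproximable Q b x} = ⋃ m : ℕ, ⋂ v : PrimitiveVector n,
      {x : RP n | v.point ∈ quadric Q →
        1 / ((m : ℝ) + 1) * (v.height : ℝ) ^ (-b) ≤ dist x v.point} := by
    ext x
    simp only [Set.mem_ofPred_eq, Set.mem_iUnion, Set.mem_iInter]
    constructor
    · rintro ⟨c, hc, h⟩
      obtain ⟨m, hm⟩ := exists_nat_one_div_lt hc
      refine ⟨m, fun v hv => le_trans ?_ (h v hv)⟩
      gcongr
    · rintro ⟨m, h⟩
      exact ⟨_, by positivity, h⟩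
  rw [h]
  refine MeasurableSet.iUnion fun m => MeasurableSet.iInter fun v => ?_
  by_cases hv : v.point ∈ quadric Q
  · simp only [hv, true_imp_iff]
    exact (isClosed_le continuous_const (continuous_id.dist continuous_const)).measurableSet
  · simp [hv]

theorem diophantineExponent_le_one {n : ℕ} {Q : QuadraticForm ℚ (Fin (n + 1) → ℚ)} {x : RP n}
    (h : ∀ m : ℕ, IsBadlyApproximable Q (1 + 1 / ((m : ℝ) + 1)) x) :
    diophantineExponent Q x ≤ 1 := by
  refine EReal.le_of_forall_lt_iff_le.mp fun z hz => ?_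
  have hz1 : (0 : ℝ) < z - 1 := by
    have : (1 : ℝ) < z := by exact_mod_cast hz
    linarith
  obtain ⟨m, hm⟩ := exists_nat_one_div_lt hz1
  have hle : diophantineExponent Q x ≤ ((1 + 1 / ((m : ℝ) + 1) : ℝ) : EReal) :=
    sInf_le ⟨_, ⟨by positivity, h m⟩, rfl⟩
  refine hle.trans ?_
  exact_mod_cast (by linarith : 1 + 1 / ((m : ℝ) + 1) ≤ z)

/-- A point which is not rational and is eventually not close to rational points of the quadric is
badly approximable. -/
theorem isBadlyApproximable_of_eventually {n : ℕ} {Q : QuadraticForm ℚ (Fin (n + 1) → ℚ)} {b : ℝ}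
    (hb : 0 ≤ b) {x : RP n} (hx : ∀ v : PrimitiveVector n, v.point ∈ quadric Q → x ≠ v.point)
    {N : ℕ} (hN : ∀ v : PrimitiveVector n, v.point ∈ quadric Q → N ≤ v.height →
      (v.height : ℝ) ^ (-b) ≤ dist x v.point) : IsBadlyApproximable Q b x := by
  -- Finitely many rational points have height below N, each at positive distance from x, so every
  -- small c serves them all.
  have h1 : ∀ᶠ c in nhdsWithin (0 : ℝ) (Set.Ioi 0), ∀ v ∈ {v : PrimitiveVector n | v.height < N},
      v.point ∈ quadric Q → c ≤ dist x v.point := by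
    refine (Filter.eventually_all_finite (PrimitiveVector.finite_height_lt N)).mpr fun v _ => ?_
    by_cases hv : v.point ∈ quadric Q
    · have : ∀ᶠ c in nhds (0 : ℝ), c < dist x v.point :=
        eventually_lt_nhds (dist_pos.mpr (hx v hv))
      filter_upwards [nhdsWithin_le_nhds this] with c hc _ using hc.le
    · exact Filter.Eventually.of_forall fun c h => absurd h hv
  have h2 : ∀ᶠ c in nhdsWithin (0 : ℝ) (Set.Ioi 0), c < 1 :=
    nhdsWithin_le_nhds (eventually_lt_nhds one_pos)
  obtain ⟨c, ⟨hc1, hc2⟩, hc0⟩ := ((h1.and h2).and self_mem_nhdsWithin).exists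
  have hc0' : 0 < c := hc0
  refine ⟨c, hc0', fun v hv => ?_⟩
  have hH : (1 : ℝ) ≤ v.height := by exact_mod_cast v.one_le_height
  rcases lt_or_ge v.height N with h | h
  · have h3 : (v.height : ℝ) ^ (-b) ≤ 1 := Real.rpow_le_one_of_one_le_of_nonpos hH (by linarith)
    calc c * (v.height : ℝ) ^ (-b) ≤ c * 1 := by gcongr
      _ ≤ _ := by simpa using hc1 v h hv
  · calc c * (v.height : ℝ) ^ (-b) ≤ 1 * (v.height : ℝ) ^ (-b) := by gcongr
      _ ≤ _ := by simpa using hN v hv h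

/-- A point of height H belongs to the dyadic block j = ⌊log₂ H⌋, whose radius (2^j)^(-b) is at
least H^(-b). -/
theorem isBadlyApproximable_of_eventually_notMem_nearRational {n : ℕ}
    {Q : QuadraticForm ℚ (Fin (n + 1) → ℚ)} {b : ℝ} (hb : 0 ≤ b) {W : Type*} {f : W → RP n}
    {U : Set W} {t : W} (ht : t ∈ U)
    (hx : ∀ v : PrimitiveVector n, v.point ∈ quadric Q → f t ≠ v.point)
    (hN : ∀ᶠ j : ℕ in Filter.atTop, t ∉ nearRational Q f U (2 ^ j) ((2 ^ j : ℝ) ^ (-b))) :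
    IsBadlyApproximable Q b (f t) := by
  obtain ⟨J, hJ⟩ := Filter.eventually_atTop.mp hN
  refine isBadlyApproximable_of_eventually hb hx (N := 2 ^ J) fun v hv hH => ?_
  by_contra hlt
  have hH0 : v.height ≠ 0 := (zero_lt_one.trans_le v.one_le_height).ne'
  have h1 : 2 ^ Nat.log 2 v.height ≤ v.height := Nat.pow_log_le_self 2 hH0
  have h2 : v.height < 2 ^ (Nat.log 2 v.height + 1) := Nat.lt_pow_succ_log_self one_lt_two _
  have h1' : (2 : ℝ) ^ Nat.log 2 v.height ≤ v.height := by exact_mod_cast h1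
  have h2' : (v.height : ℝ) < 2 ^ (Nat.log 2 v.height + 1) := by exact_mod_cast h2
  refine hJ _ (Nat.le_log_of_pow_le one_lt_two hH) ⟨ht, v, hv, h1', ?_, ?_⟩
  · rwa [pow_succ'] at h2'
  · exact (not_le.mp hlt).trans_le
      (Real.rpow_le_rpow_of_nonpos (by positivity) h1' (by linarith))

/-! ### Charts -/

/-- The linear part of the affine map `affineVec i`. -/
noncomputable def affineLin {n : ℕ} (i : Fin (n + 1)) : EuclideanSpace ℝ (Fin n) →L[ℝ] Coord n :=
  LinearMap.toContinuousLinearMap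
    { toFun := fun y => affineVec i y - affineVec i 0
      map_add' := fun y z => by
        ext a
        rcases Fin.eq_self_or_eq_succAbove i a with rfl | ⟨a, rfl⟩ <;> simp [affineVec]
      map_smul' := fun r y => by
        ext a
        rcases Fin.eq_self_or_eq_succAbove i a with rfl | ⟨a, rfl⟩ <;> simp [affineVec] }

theorem affineVec_eq {n : ℕ} (i : Fin (n + 1)) (y : EuclideanSpace ℝ (Fin n)) :
    affineVec i y = affineLin i y + affineVec i 0 :=
  (sub_add_cancel (affineVec i y) (affineVec i 0)).symm

theorem norm_affineLin {n : ℕ} (i : Fin (n + 1)) (y : EuclideanSpace ℝ (Fin n)) :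
    ‖affineLin i y‖ = ‖y‖ := by
  have h := norm_affineVec_sub i y 0
  rwa [sub_zero] at h

theorem eq_of_affinePoint_eq {n : ℕ} {i : Fin (n + 1)} {y z : EuclideanSpace ℝ (Fin n)}
    (h : affinePoint i y = affinePoint i z) : y = z := by
  obtain ⟨a, ha⟩ := (Projectivization.mk_eq_mk_iff' ℝ _ _ _ _).mp h
  have h1 : a = 1 := by
    have := congrArg (fun u : Coord n => u i) ha
    simpa [affineVec] using this
  rw [h1, one_smul] at ha
  rw [← sub_eq_zero, ← norm_eq_zero, ← norm_affineVec_sub i, ha, sub_self, norm_zero]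

theorem summable_measure_nearRational {n : ℕ} {Q : QuadraticForm ℚ (Fin (n + 1) → ℚ)}
    {W : Type*} [NormedAddCommGroup W] [NormedSpace ℝ W] [FiniteDimensional ℝ W]
    [MeasurableSpace W] [BorelSpace W] (μ : Measure W) [μ.IsAddHaarMeasure]
    (hW : rationalRank Q ≤ Module.finrank ℝ W) {i : Fin (n + 1)}
    {f : W → EuclideanSpace ℝ (Fin n)} {A : W →L[ℝ] Coord n} {κ : NNReal} (hκ : 0 < κ)
    (hA : ∀ s, 2 * κ * ‖s‖ ≤ ‖A s‖) {p : W} {R : ℝ}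
    (hF : ApproximatesLinearOn (fun t => affineVec i (f t)) A (Metric.closedBall p R) κ)
    {K : ℝ} (hK : ∀ t ∈ Metric.closedBall p R, ‖affineVec i (f t)‖ ≤ K) {b : ℝ} (hb : 1 < b) :
    ∃ j₀ : ℕ, ∑' j : ℕ, μ (nearRational Q (fun t => affinePoint i (f t)) (Metric.closedBall p R)
      (2 ^ (j + j₀)) ((2 ^ (j + j₀) : ℝ) ^ (-b))) ≠ ⊤ := by
  obtain ⟨C, hC0, hC⟩ := exists_abs_realForm_le Q
  obtain ⟨ε, hε0, hε⟩ := exists_polar_gap Q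
  set C₁ : ℝ := 2 * (n + 1) * K ^ 2 with hC₁
  have hC₁0 : 0 ≤ C₁ := by positivity
  have hκ' : (0 : ℝ) < κ := hκ
  -- With ρ = a/2^j and C₁δ ≤ ρ, the factor h² cancels in the polar estimate, so one a works at all
  -- heights; a < 1 gives ρ ≤ 1.
  obtain ⟨a, ⟨haε, ha1⟩, ha0⟩ : ∃ a : ℝ,
      (4 * C * (2 + 10 * (‖A‖ + κ)) ^ 2 * a ^ 2 < ε ∧ a < 1) ∧ 0 < a := by
    have h1 : Filter.Tendsto (fun a : ℝ => 4 * C * (2 + 10 * (‖A‖ + κ)) ^ 2 * a ^ 2)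
        (nhdsWithin 0 (Set.Ioi 0)) (nhds 0) := by
      refine Filter.Tendsto.mono_left ?_ nhdsWithin_le_nhds
      have : Continuous fun a : ℝ => 4 * C * (2 + 10 * (‖A‖ + κ)) ^ 2 * a ^ 2 := by fun_prop
      simpa using this.tendsto 0
    exact (((h1.eventually_lt_const hε0).and
      (nhdsWithin_le_nhds (eventually_lt_nhds one_pos))).and self_mem_nhdsWithin).exists
  -- The geometric ratio: hδ = x^j, and b > 1 gives x < 1.
  set x : ℝ := (2 : ℝ) ^ (1 - b) with hx
  have hx0 : 0 < x := by positivity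
  have hx1 : x < 1 := Real.rpow_lt_one_of_one_lt_of_neg one_lt_two (by linarith)
  have hδx : ∀ j : ℕ, (2 ^ j : ℝ) ^ (-b) = x ^ j / 2 ^ j := by
    intro j
    have h2 : (0 : ℝ) < 2 ^ j := by positivity
    rw [eq_div_iff h2.ne', hx, ← Real.rpow_natCast (2 ^ (1 - b)) j, ← Real.rpow_mul zero_le_two,
      mul_comm (1 - b), Real.rpow_mul zero_le_two, Real.rpow_natCast]
    conv_lhs => rw [← Real.rpow_one ((2 : ℝ) ^ j), ← Real.rpow_mul h2.le, ← Real.rpow_add h2]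
    congr 1
    ring
  have htend : ∀ c : ℝ, Filter.Tendsto (fun j : ℕ => c * x ^ j) Filter.atTop (nhds 0) := by
    intro c
    simpa using (tendsto_pow_atTop_nhds_zero_of_lt_one hx0.le hx1).const_mul c
  -- Eventually δ is small enough for the chart comparison, and both C₁δ and the slab step 3C₁δ/κ
  -- are below ρ.
  have hev : ∀ᶠ j : ℕ in Filter.atTop, 2 * ((n + 1) * |K|) * x ^ j < 1 ∧ C₁ * x ^ j < a ∧
      3 * C₁ / κ * x ^ j < a :=
    ((htend _).eventually_lt_const one_pos).and
      (((htend _).eventually_lt_const ha0).and ((htend _).eventually_lt_const ha0))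
  obtain ⟨j₀, hj₀⟩ := Filter.eventually_atTop.mp hev
  set D : ℝ := 2 * 6 ^ Module.finrank ℝ W * (3 * C₁ / κ / a) with hD
  have hD0 : 0 ≤ D := by positivity
  have hbound : ∀ j ≥ j₀, μ (nearRational Q (fun t => affinePoint i (f t))
      (Metric.closedBall p R) (2 ^ j) ((2 ^ j : ℝ) ^ (-b)))
      ≤ ENNReal.ofReal (D * x ^ j) * μ (Metric.closedBall p (R + 1)) := by
    intro j hj
    obtain ⟨e1, e2, e3⟩ := hj₀ j hj
    have h2 : (1 : ℝ) ≤ 2 ^ j := one_le_pow₀ one_le_two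
    have h20 : (0 : ℝ) < 2 ^ j := by positivity
    have hρ0 : 0 < a / 2 ^ j := by positivity
    have hxj : x ^ j / 2 ^ j ≤ x ^ j := div_le_self (by positivity) h2
    rw [hδx]
    refine measure_le_of_forall_ball μ hρ0 ?_ (fun t ht => ht.1) fun q _ => ?_
    · rw [div_le_one h20]
      linarith
    refine (measure_nearRational_inter_ball_le μ hW hκ hA hF hK hC hC0.le hε (by positivity)
      ?_ ?_ ?_ q).trans (le_of_eq ?_)
    · refine le_trans ?_ e1.le
      calc 2 * ((n + 1) * (x ^ j / 2 ^ j) * K) ≤ 2 * ((n + 1) * (x ^ j / 2 ^ j) * |K|) := by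
            gcongr
            exact le_abs_self K
        _ ≤ 2 * ((n + 1) * (x ^ j) * |K|) := by gcongr
        _ = _ := by ring
    · refine lt_of_le_of_lt ?_ haε
      have h3 : 2 * (C₁ * (x ^ j / 2 ^ j)) + 10 * (‖A‖ + κ) * (a / 2 ^ j)
          ≤ (2 + 10 * (‖A‖ + κ)) * a / 2 ^ j := by
        have h4 : C₁ * (x ^ j / 2 ^ j) ≤ a / 2 ^ j := by
          rw [← mul_div_assoc]
          gcongr
        have h5 : (2 + 10 * (‖A‖ + κ)) * a / 2 ^ j
            = 2 * (a / 2 ^ j) + 10 * (‖A‖ + κ) * (a / 2 ^ j) := by ring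
        linarith
      calc _ ≤ 4 * (2 ^ j) ^ 2 * (C * ((2 + 10 * (‖A‖ + κ)) * a / 2 ^ j) ^ 2) := by gcongr
        _ = _ := by field_simp
    · have h3 : 3 * (C₁ * (x ^ j / 2 ^ j)) / κ = 3 * C₁ / κ * x ^ j / 2 ^ j := by ring
      rw [h3]
      gcongr
    · congr 2
      rw [hD]
      field_simp
      exact hC₁.symm
  refine ⟨j₀, ne_top_of_le_ne_top ?_ (ENNReal.tsum_le_tsum fun j => hbound _ (Nat.le_add_left _ _))⟩
  rw [ENNReal.tsum_mul_right]
  refine ENNReal.mul_ne_top ?_ (isCompact_closedBall p (R + 1)).measure_lt_top.ne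
  have hsum : Summable fun j : ℕ => D * x ^ (j + j₀) :=
    (((summable_nat_add_iff j₀).mpr (summable_geometric_of_lt_one hx0.le hx1)).mul_left D)
  rw [← ENNReal.ofReal_tsum_of_nonneg (fun j => by positivity) hsum]
  exact ENNReal.ofReal_ne_top

/-- Near a point where a parametrization is an immersion, almost every parameter gives a badly
approximable point. -/
theorem exists_nhds_measure_not_isBadlyApproximable_eq_zero {n : ℕ}
    {Q : QuadraticForm ℚ (Fin (n + 1) → ℚ)}
    {W : Type*} [NormedAddCommGroup W] [NormedSpace ℝ W] [FiniteDimensional ℝ W]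
    [MeasurableSpace W] [BorelSpace W] (μ : Measure W) [μ.IsAddHaarMeasure]
    (hW : rationalRank Q ≤ Module.finrank ℝ W) (i : Fin (n + 1))
    {f : W → EuclideanSpace ℝ (Fin n)} {A : W →L[ℝ] EuclideanSpace ℝ (Fin n)} {p : W}
    (hf : HasStrictFDerivAt f A p) (hA : Function.Injective A) {b : ℝ} (hb : 1 < b) :
    ∃ U ∈ nhds p, μ {t ∈ U | ¬ IsBadlyApproximable Q b (affinePoint i (f t))} = 0 := by
  obtain ⟨k, hk0, hk⟩ := A.toLinearMap.exists_antilipschitzWith (LinearMap.ker_eq_bot.mpr hA)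
  -- Then ‖A' s‖ ≥ 2κ‖s‖, so a linearization error κ still leaves expansion by κ.
  set κ : NNReal := (2 * k)⁻¹ with hκ
  have hκ0 : 0 < κ := by positivity
  set A' : W →L[ℝ] Coord n := (affineLin i).comp A with hA'
  have hA'n : ∀ s, 2 * κ * ‖s‖ ≤ ‖A' s‖ := by
    intro s
    have h1 : ‖s‖ ≤ k * ‖A s‖ := hk.le_mul_norm (map_zero A) s
    have hk0' : (0 : ℝ) < k := hk0
    have h2 : (2 * (κ : ℝ)) = (k : ℝ)⁻¹ := by
      rw [hκ]
      push_cast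
      field_simp
    rw [h2, hA', ContinuousLinearMap.comp_apply, norm_affineLin, inv_mul_le_iff₀ hk0']
    exact h1
  have hF : HasStrictFDerivAt (fun t => affineVec i (f t)) A' p := by
    simp only [affineVec_eq i (f _)]
    exact ((affineLin i).hasStrictFDerivAt.comp p hf).add_const _
  obtain ⟨s, hs, hFs⟩ := hF.approximates_deriv_on_nhds (Or.inr hκ0)
  have hKs : ∀ᶠ t in nhds p, ‖affineVec i (f t)‖ < ‖affineVec i (f p)‖ + 1 :=
    hF.continuousAt.norm.eventually_lt_const (lt_add_one _)
  obtain ⟨R, hR, hRs⟩ := Metric.nhds_basis_closedBall.mem_iff.mp (Filter.inter_mem hs hKs)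
  have hFU := hFs.mono_set fun t ht => (hRs ht).1
  obtain ⟨j₀, hj₀⟩ := summable_measure_nearRational (Q := Q) μ hW hκ0 hA'n hFU
    (fun t ht => (hRs ht).2.le) hb
  have hbc := ae_eventually_notMem hj₀
  have hrat : ∀ᵐ t ∂μ, t ∈ Metric.closedBall p R → ∀ v : PrimitiveVector n,
      v.point ∈ quadric Q → affinePoint i (f t) ≠ v.point := by
    have h1 : ∀ v : PrimitiveVector n, ∀ᵐ t ∂μ, t ∈ Metric.closedBall p R →
        v.point ∈ quadric Q → affinePoint i (f t) ≠ v.point := by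
      intro v
      by_cases hv : v.point ∈ quadric Q
      · have : Nontrivial W := Module.nontrivial_of_finrank_pos
          (R := ℝ) (zero_lt_one.trans_le ((one_le_rationalRank hv).trans hW))
        -- Expansion makes the parametrization injective on the ball, so each rational point has at
        -- most one parameter.
        have hsub : {t ∈ Metric.closedBall p R | affinePoint i (f t) = v.point}.Subsingleton := by
          rintro t ⟨ht, htv⟩ t' ⟨ht', htv'⟩
          have h2 := hFU t ht t' ht'
          simp only [eq_of_affinePoint_eq (htv.trans htv'.symm), sub_self, zero_sub,
            norm_neg] at h2
          have h3 := hA'n (t - t')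
          have h4 : (κ : ℝ) * ‖t - t'‖ ≤ 0 := by linarith
          have h5 : ‖t - t'‖ ≤ 0 := nonpos_of_mul_nonpos_right h4 (by exact_mod_cast hκ0)
          exact sub_eq_zero.mp (norm_le_zero_iff.mp h5)
        filter_upwards [compl_mem_ae_iff.mpr (hsub.measure_zero μ)] with t ht htU _ h
        exact ht ⟨htU, h⟩
      · exact Filter.Eventually.of_forall fun t _ h => absurd h hv
    filter_upwards [ae_all_iff.mpr h1] with t ht htU v using ht v htU
  refine ⟨Metric.closedBall p R, Metric.closedBall_mem_nhds p hR, ?_⟩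
  have hae : ∀ᵐ t ∂μ, t ∈ Metric.closedBall p R →
      IsBadlyApproximable Q b (affinePoint i (f t)) := by
    filter_upwards [hbc, hrat] with t h1 h2 ht
    refine isBadlyApproximable_of_eventually_notMem_nearRational (by linarith)
      (f := fun t => affinePoint i (f t)) ht (h2 ht) ?_
    rw [← Filter.map_add_atTop_eq_nat j₀, Filter.eventually_map]
    exact h1
  refine measure_mono_null ?_ (ae_iff.mp hae)
  rintro t ⟨ht, hn⟩
  exact fun h => hn (h ht)

/-! ### Submanifolds -/

/-- Locally S is the image of W under `φ.symm`, an immersion because the derivative of φ is a left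
inverse. On W, k-dimensional Hausdorff measure is a Haar measure, and Lipschitz maps preserve
Hausdorff-null sets. -/
theorem hausdorffMeasure_not_isBadlyApproximable_eq_zero {n k : ℕ}
    {Q : QuadraticForm ℚ (Fin (n + 1) → ℚ)} (hk : rationalRank Q ≤ k) (i : Fin (n + 1))
    {S : Set (EuclideanSpace ℝ (Fin n))} (hS : IsSmoothSubmanifoldEuclidean k S) {b : ℝ}
    (hb : 1 < b) :
    μH[(k : ℝ)] {y ∈ S | ¬ IsBadlyApproximable Q b (affinePoint i y)} = 0 := by
  refine measure_null_of_locally_null _ ?_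
  rintro y ⟨hy, -⟩
  obtain ⟨φ, W, hyφ, hφ, hφs, rfl, hφW⟩ := hS y hy
  have hyW : φ y ∈ W := (hφW.subset ⟨y, ⟨hy, hyφ⟩, rfl⟩).2
  set p : W := ⟨φ y, hyW⟩ with hp
  have hyt : φ y ∈ φ.target := φ.map_source hyφ
  have hD : ContDiffAt ℝ ∞ φ.symm (φ y) := hφs.contDiffAt (φ.open_target.mem_nhds hyt)
  have hD' : ContDiffAt ℝ ∞ φ y := hφ.contDiffAt (φ.open_source.mem_nhds hyφ)
  have hs1 := hD.hasStrictFDerivAt (by simp)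
  have hs2 := hD'.hasStrictFDerivAt (by simp)
  have hinv : (fderiv ℝ φ y).comp (fderiv ℝ φ.symm (φ y)) = ContinuousLinearMap.id ℝ _ := by
    have h1 : HasFDerivAt (φ ∘ φ.symm) ((fderiv ℝ φ y).comp (fderiv ℝ φ.symm (φ y))) (φ y) := by
      refine HasFDerivAt.comp _ ?_ hs1.hasFDerivAt
      rw [φ.left_inv hyφ]
      exact hs2.hasFDerivAt
    have h2 : HasFDerivAt (φ ∘ φ.symm) (ContinuousLinearMap.id ℝ _) (φ y) :=
      (hasFDerivAt_id _).congr_of_eventuallyEq (φ.eventually_right_inverse hyt)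
    exact h1.unique h2
  have hinj : Function.Injective ((fderiv ℝ φ.symm (φ y)).comp W.subtypeL) := by
    intro s t hst
    have := congrArg (fderiv ℝ φ y) hst
    have h3 : ∀ z, fderiv ℝ φ y (fderiv ℝ φ.symm (φ y) z) = z := fun z =>
      congrArg (fun T : EuclideanSpace ℝ (Fin n) →L[ℝ] EuclideanSpace ℝ (Fin n) => T z) hinv
    simp only [ContinuousLinearMap.comp_apply, h3] at this
    exact Subtype.ext this
  have hf : HasStrictFDerivAt (fun t : W => φ.symm t)
      ((fderiv ℝ φ.symm (φ y)).comp W.subtypeL) p :=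
    HasStrictFDerivAt.comp p (f := W.subtypeL) hs1 W.subtypeL.hasStrictFDerivAt
  have := isAddHaarMeasure_hausdorffMeasure (E := W)
  obtain ⟨U, hU, hUμ⟩ := exists_nhds_measure_not_isBadlyApproximable_eq_zero (Q := Q)
    (μH[(Module.finrank ℝ W : ℝ)] : Measure W) hk i hf hinj hb
  obtain ⟨c, V, hV, hVc⟩ := hf.exists_lipschitzOnWith
  obtain ⟨O, hO, hOp⟩ : ∃ O ∈ nhds (φ y), ∀ t : W, (t : EuclideanSpace ℝ (Fin n)) ∈ O →
      t ∈ U ∩ V := by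
    obtain ⟨O, hO, h⟩ := (mem_nhds_subtype (W : Set (EuclideanSpace ℝ (Fin n))) p (U ∩ V)).mp
      (Filter.inter_mem hU hV)
    exact ⟨O, hO, fun t ht => h ht⟩
  refine ⟨{z ∈ S | ¬ IsBadlyApproximable Q b (affinePoint i z)} ∩ (φ.source ∩ φ ⁻¹' O),
    Filter.inter_mem self_mem_nhdsWithin (nhdsWithin_le_nhds (Filter.inter_mem
      (φ.open_source.mem_nhds hyφ) (hD'.continuousAt.preimage_mem_nhds hO))), ?_⟩
  set B : Set W := {t ∈ U | ¬ IsBadlyApproximable Q b (affinePoint i (φ.symm t))} ∩ V with hB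
  have hsub : {z ∈ S | ¬ IsBadlyApproximable Q b (affinePoint i z)} ∩ (φ.source ∩ φ ⁻¹' O)
      ⊆ (fun t : W => φ.symm t) '' B := by
    rintro z ⟨⟨hz, hzb⟩, hzφ, hzO⟩
    have hzW : φ z ∈ W := (hφW.subset ⟨z, ⟨hz, hzφ⟩, rfl⟩).2
    have h1 := hOp ⟨φ z, hzW⟩ hzO
    refine ⟨⟨φ z, hzW⟩, ⟨⟨h1.1, ?_⟩, h1.2⟩, φ.left_inv hzφ⟩
    simpa only [φ.left_inv hzφ] using hzb
  refine measure_mono_null hsub (le_antisymm ?_ zero_le)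
  refine ((hVc.mono Set.inter_subset_right).hausdorffMeasure_image_le (Nat.cast_nonneg _)).trans ?_
  rw [measure_mono_null Set.inter_subset_left hUμ, mul_zero]

theorem hausdorffMeasure_submanifold_not_isBadlyApproximable_eq_zero {n k : ℕ}
    {Q : QuadraticForm ℚ (Fin (n + 1) → ℚ)} (hk : rationalRank Q ≤ k)
    {M : Set (RP n)} (hM : IsSmoothSubmanifold k M) {b : ℝ} (hb : 1 < b) :
    μH[(k : ℝ)] {x ∈ M | ¬ IsBadlyApproximable Q b x} = 0 := by
  have hsub : {x ∈ M | ¬ IsBadlyApproximable Q b x} ⊆ ⋃ i : Fin (n + 1), affinePoint i ''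
      {y ∈ affinePoint i ⁻¹' M | ¬ IsBadlyApproximable Q b (affinePoint i y)} := by
    rintro x ⟨hx, hxb⟩
    obtain ⟨i, y, rfl⟩ := exists_affinePoint_eq x
    exact Set.mem_iUnion.mpr ⟨i, y, ⟨hx, hxb⟩, rfl⟩
  refine measure_mono_null hsub (measure_iUnion_null fun i => le_antisymm ?_ zero_le)
  refine (((lipschitzWith_affinePoint i).lipschitzOnWith).hausdorffMeasure_image_le
    (Nat.cast_nonneg k)).trans ?_
  rw [hausdorffMeasure_not_isBadlyApproximable_eq_zero hk i (hM i) hb, mul_zero]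

end QuadricApprox

/-- `M` is a smooth submanifold of the rational quadric `X = quadric Q` with `dim M = k ≥ rk_ℚ X`;
Lebesgue measure on `M` is the restriction to `M` of the `k`-dimensional Hausdorff measure. -/
theorem theorem2p1 (n : ℕ) (Q : QuadraticForm ℚ (Fin (n + 1) → ℚ)) (k : ℕ)
    (M : Set (QuadricApprox.RP n)) (hM : QuadricApprox.IsSmoothSubmanifold k M)
    (hMX : M ⊆ QuadricApprox.quadric Q) (hk : QuadricApprox.rationalRank Q ≤ k) :
    ∀ᵐ x ∂((μH[(k : ℝ)] : Measure (QuadricApprox.RP n)).restrict M),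
      QuadricApprox.diophantineExponent Q x ≤ 1 := by
  have h : ∀ m : ℕ, ∀ᵐ x ∂((μH[(k : ℝ)] : Measure (QuadricApprox.RP n)).restrict M),
      QuadricApprox.IsBadlyApproximable Q (1 + 1 / ((m : ℝ) + 1)) x := by
    intro m
    rw [ae_restrict_iff (QuadricApprox.measurableSet_isBadlyApproximable Q _)]
    have hb : (1 : ℝ) < 1 + 1 / ((m : ℝ) + 1) := lt_add_of_pos_right _ (by positivity)
    refine measure_mono_null ?_
      (QuadricApprox.hausdorffMeasure_submanifold_not_isBadlyApproximable_eq_zero hk hM hb)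
    intro x hx
    simpa using hx
  filter_upwards [ae_all_iff.mpr h] with x hx
  exact QuadricApprox.diophantineExponent_le_one hx
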